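/- Let $R$ be a finite, reduced, crystallographic root system spanning the real vector space $\mathbb{R}R$, with automorphism group $A=\operatorname{Aut}(R)$ (the linear automorphisms of $\mathbb{R}R$ that map $R$ onto itself). For a system $\Delta$ of simple roots of $R$ and a subset $\Theta\subseteq\Delta$, let $W_\Theta=\langle s_\alpha : \alpha\in\Theta\rangle$ be the subgroup of $A$ generated by the reflections in the roots in $\Theta$, let $\operatorname{Aut}(R,\Delta)$ be the setwise stabilizer of $\Delta$ in $A$, and put $$A_{\Theta\subseteq\Delta}=W_\Theta\rtimes\operatorname{Stab}_{\operatorname{Aut}(R,\Delta)}(\Theta),$$ where $\operatorname{Stab}$ denotes the setwise stabilizer. A subgroup of $A$ is called parabolic if it has the form $A_{\Theta\subseteq\Delta}$ for some system $\Delta$ of simple roots of $R$ and some $\Theta\subseteq\Delta$, and an element of $A$ is called elliptic if it belongs to no proper parabolic subgroup of $A$. Then an element $w\in A$ is elliptic if and only if it has no nonzero fixed vector in $\mathbb{R}R$. -/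

import Mathlib

open scoped Pointwise

namespace RootPairing

variable {ι R M N : Type*} [CommRing R] [AddCommGroup M] [Module R M] [AddCommGroup N] [Module R N]

/-- For a set `I` of (indices of) roots, the subgroup `W_I` of the automorphism group of a root
system generated by the reflections in the roots belonging to `I`. -/
noncomputable def reflectionSubgroup (P : RootPairing ι R M N) (I : Set ι) : Subgroup P.Aut :=
  Subgroup.closure (Equiv.reflection P '' I)

/-- For a system `b` of simple roots and a set `I` of roots, the setwise stabiliser of `I` in
`Aut(P, b)`, where `Aut(P, b)` is the setwise stabiliser of `b` in the automorphism group. -/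
noncomputable def simpleStabilizer {P : RootPairing ι R M N} (b : P.Base) (I : Set ι) : Subgroup P.Aut :=
  MulAction.stabilizer P.Aut (b.support : Set ι) ⊓ MulAction.stabilizer P.Aut I

/-- The group `A_{I ⊆ b} = W_I ⋊ stab_{Aut(P, b)}(I)`: since the second factor normalises the
first, the subgroup generated by the two factors is the set of their products, see
`mem_parabolicSubgroup_iff`. -/
noncomputable def parabolicSubgroup {P : RootPairing ι R M N} (b : P.Base) (I : Set ι) : Subgroup P.Aut :=
  P.reflectionSubgroup I ⊔ simpleStabilizer b I

/-- A subgroup of the automorphism group of a root system is parabolic if it is of the form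
`A_{I ⊆ b}` for some system `b` of simple roots and some subset `I` of `b`. -/
def IsParabolic (P : RootPairing ι R M N) (Q : Subgroup P.Aut) : Prop :=
  ∃ (b : P.Base) (I : Set ι), I ⊆ (b.support : Set ι) ∧ Q = parabolicSubgroup b I

/-- An automorphism of a root system is elliptic if it belongs to no proper parabolic subgroup of
the automorphism group. -/
def IsElliptic (P : RootPairing ι R M N) (w : P.Aut) : Prop :=
  ∀ Q : Subgroup P.Aut, P.IsParabolic Q → Q ≠ ⊤ → w ∉ Q

theorem conj_reflection (P : RootPairing ι R M N) (g : P.Aut) (i : ι) :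
    g * Equiv.reflection P i * g⁻¹ = Equiv.reflection P (g • i) := by
  apply Equiv.weightHom_injective P
  ext x
  change g • (Equiv.reflection P i • (g⁻¹ • x)) = Equiv.reflection P (g • i) • x
  obtain ⟨y, rfl⟩ : ∃ y, x = g • y := ⟨g⁻¹ • x, by simp⟩
  have h : P.toLinearMap (g • y) (P.coroot (g • i)) = P.toLinearMap y (P.coroot i) := by
    have h1 := LinearMap.congr_fun
      (Hom.weight_coweight_transpose_apply P P (P.coroot (g • i)) g.toHom) y
    rw [Hom.coroot_coweightMap_apply] at h1
    have h2 : g.toHom.indexEquiv.symm (g • i) = i := g.toHom.indexEquiv.symm_apply_apply i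
    rw [h2] at h1
    exact h1
  have hr : P.root (g • i) = g • P.root i := Equiv.root_indexEquiv_eq_smul (P := P) i g
  rw [inv_smul_smul, Equiv.reflection_smul, Equiv.reflection_smul, reflection_apply,
    reflection_apply, smul_sub, smul_comm g, ← hr]
  congr 2
  exact h.symm

theorem simpleStabilizer_le_normalizer {P : RootPairing ι R M N} (b : P.Base) (I : Set ι) :
    simpleStabilizer b I ≤ Subgroup.normalizer (P.reflectionSubgroup I : Set P.Aut) := by
  intro g hg
  have hI : g • I = I := hg.2
  rw [Subgroup.mem_normalizer_iff_map_conj_eq, reflectionSubgroup, MonoidHom.map_closure]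
  congr 1
  conv_rhs => rw [← hI]
  rw [← Set.image_smul, Set.image_image, Set.image_image]
  exact Set.image_congr fun i _ ↦ conj_reflection P g i

theorem mem_parabolicSubgroup_iff {P : RootPairing ι R M N} (b : P.Base) (I : Set ι) (w : P.Aut) :
    w ∈ parabolicSubgroup b I ↔
      ∃ u ∈ P.reflectionSubgroup I, ∃ v ∈ simpleStabilizer b I, u * v = w := by
  rw [← SetLike.mem_coe, parabolicSubgroup,
    Subgroup.coe_mul_of_right_le_normalizer_left _ _ (simpleStabilizer_le_normalizer b I)]
  rfl

end RootPairing

/-!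
A linear endomorphism `w` of the finite-dimensional weight space fixes a nonzero vector if and only
if its transpose does, that is, if and only if some nonzero linear functional is `w`-invariant.
Functionals are easily compared with bases. Composing an invariant functional with a `ℚ`-linear map
to `ℚ` makes its values at the roots comparable with zero, and a small perturbation of it which
vanishes at no root determines a base with respect to which it is dominant. If `w` leaves a dominant
functional invariant and makes a simple root `α` negative, then the functional vanishes at `α`, and
`w s_α` has fewer inversions than `w`; hence `w` lies in the parabolic subgroup of the simple roots
at which the functional vanishes. Conversely, the parabolic subgroup of a proper subset `Θ` of a
base leaves invariant the functional which is `0` on `Θ` and `1` on the remaining simple roots.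
-/

namespace RootSystemAut

open RootPairing RootPairing.Base Module

lemma exists_ne_zero_apply_eq_self_iff_exists_dual {K V : Type*} [Field K] [AddCommGroup V]
    [Module K V] [FiniteDimensional K V] (f : End K V) :
    (∃ x, x ≠ 0 ∧ f x = x) ↔ ∃ φ : Dual K V, φ ≠ 0 ∧ φ ∘ₗ f = φ := by
  let d : End K V := f - 1
  have hd : Function.Injective d ↔ Function.Injective d.dualMap := by
    rw [LinearMap.dualMap_injective_iff, LinearMap.injective_iff_surjective]
  have hdual (φ : Dual K V) : d.dualMap φ = φ ∘ₗ f - φ := by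
    ext x
    simp [d]
  rw [injective_iff_map_eq_zero, injective_iff_map_eq_zero] at hd
  simpa only [d, not_forall, LinearMap.sub_apply, End.one_apply, hdual, sub_eq_zero, exists_prop,
    and_comm] using not_congr hd

lemma exists_nsmul_add_ne_zero_and_nonneg {ι S : Type*} [Finite ι] [AddCommGroup S] [LinearOrder S]
    [IsOrderedAddMonoid S] [Archimedean S] (a c : ι → S) (hc : ∀ i, c i ≠ 0) :
    ∃ n : ℕ, ∀ i, n • a i + c i ≠ 0 ∧ (0 < n • a i + c i → 0 ≤ a i) := by
  refine (Filter.eventually_all (l := Filter.atTop).mpr fun i ↦ ?_).exists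
  rcases lt_trichotomy (a i) 0 with ha | ha | ha
  · have : Nontrivial S := ⟨_, _, ha.ne⟩
    filter_upwards [(Filter.tendsto_id.atTop_nsmul_neg_const ha).eventually_lt_atBot (-c i)]
      with n hn
    have hneg : n • a i + c i < 0 := lt_neg_iff_add_neg.mp hn
    exact ⟨hneg.ne, fun h ↦ absurd h hneg.not_gt⟩
  · simp [ha, hc i]
  · have : Nontrivial S := ⟨_, _, ha.ne⟩
    filter_upwards [(Filter.tendsto_id.atTop_nsmul_const ha).eventually_gt_atTop (-c i)]
      with n hn
    exact ⟨(neg_lt_iff_pos_add.mp hn).ne', fun _ ↦ ha.le⟩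

variable {ι R M N S : Type*} [CommRing R] [AddCommGroup M] [Module R M] [AddCommGroup N]
  [Module R N] [AddCommGroup S] {P : RootPairing ι R M N}

lemma root_smul (g : P.Aut) (i : ι) : P.root (g • i) = g • P.root i :=
  Equiv.root_indexEquiv_eq_smul (P := P) i g

lemma reflection_smul_index (i j : ι) : Equiv.reflection P i • j = P.reflectionPerm i j := rfl

lemma smul_reflectionPerm_self (g : P.Aut) (i : ι) :
    g • P.reflectionPerm i i = P.reflectionPerm (g • i) (g • i) := by
  apply P.root.injective
  rw [root_smul, root_reflectionPerm, RootPairing.reflection_apply_self, root_reflectionPerm,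
    RootPairing.reflection_apply_self, smul_neg, root_smul]

section FunctionalStabilizer

/-- The automorphisms which preserve the values at the roots of an additive functional on the
weight space. Only additivity is required, so that functionals on a space over any field of
characteristic zero may take values in `ℚ`. -/
def functionalStabilizer (P : RootPairing ι R M N) (φ : M →+ S) : Subgroup P.Aut where
  carrier := {g | ∀ i, φ (P.root (g • i)) = φ (P.root i)}
  one_mem' := by simp
  mul_mem' {g h} hg hh i := by rw [mul_smul, hg, hh]
  inv_mem' {g} hg i := by rw [← hg, smul_inv_smul]

lemma mem_functionalStabilizer_iff {φ : M →+ S} {g : P.Aut} :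
    g ∈ functionalStabilizer P φ ↔ ∀ i, φ (P.root (g • i)) = φ (P.root i) :=
  Iff.rfl

lemma dual_ext_root [P.IsRootSystem] {φ ψ : Dual R M} (h : ∀ i, φ (P.root i) = ψ (P.root i)) :
    φ = ψ :=
  LinearMap.ext_on_range (IsRootSystem.span_root_eq_top (P := P)) h

lemma mem_functionalStabilizer_dual_iff [P.IsRootSystem] {φ : Dual R M} {g : P.Aut} :
    g ∈ functionalStabilizer P φ.toAddMonoidHom ↔ φ ∘ₗ Equiv.weightHom P g = φ := by
  rw [mem_functionalStabilizer_iff]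
  refine ⟨fun h ↦ dual_ext_root (P := P) fun i ↦ ?_, fun h i ↦ ?_⟩
  · exact (congrArg φ (root_smul g i)).symm.trans (h i)
  · rw [root_smul]
    exact LinearMap.congr_fun h (P.root i)

lemma reflection_mem_functionalStabilizer [P.IsCrystallographic] {φ : M →+ S} {i : ι}
    (hi : φ (P.root i) = 0) : Equiv.reflection P i ∈ functionalStabilizer P φ := fun j ↦ by
  rw [reflection_smul_index, root_reflectionPerm, reflection_apply_root' ℤ, map_sub, map_zsmul,
    hi, smul_zero, sub_zero]

lemma apply_root_eq_zero_of_reflection_mem [IsAddTorsionFree S] {φ : M →+ S} {i : ι}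
    (hi : Equiv.reflection P i ∈ functionalStabilizer P φ) : φ (P.root i) = 0 := by
  have h := hi i
  rwa [reflection_smul_index, root_reflectionPerm, RootPairing.reflection_apply_self, map_neg,
    neg_eq_self] at h

lemma apply_root_eq_of_forall_mem_support (b : P.Base) {φ ψ : M →+ S}
    (h : ∀ i ∈ b.support, φ (P.root i) = ψ (P.root i)) (i : ι) :
    φ (P.root i) = ψ (P.root i) := by
  refine LinearMap.eqOn_span (f := φ.toIntLinearMap) (g := ψ.toIntLinearMap) ?_
    (b.root_mem_span_int i)
  rintro - ⟨j, hj, rfl⟩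
  exact h j hj

lemma mem_functionalStabilizer_of_forall_mem_support (b : P.Base) {φ : M →+ S} {g : P.Aut}
    (h : ∀ i ∈ b.support, φ (P.root (g • i)) = φ (P.root i)) : g ∈ functionalStabilizer P φ := by
  intro i
  simp only [root_smul] at h ⊢
  exact apply_root_eq_of_forall_mem_support b
    (φ := φ.comp (DistribSMul.toAddMonoidHom M g)) h i

end FunctionalStabilizer

section Positivity

variable [CharZero R] {b : P.Base}

lemma isPos_reflectionPerm_self_iff {i : ι} : b.IsPos (P.reflectionPerm i i) ↔ ¬ b.IsPos i :=
  IsPos.neg_iff_not b i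

variable [Finite ι] [IsDomain R] [P.IsCrystallographic]

lemma mem_support_or_exists_root_eq_add {i : ι} (hi : b.IsPos i) :
    i ∈ b.support ∨ ∃ j k, b.IsPos j ∧ b.IsPos k ∧ P.root i = P.root j + P.root k := by
  obtain ⟨j, hj, hji⟩ := hi.exists_mem_support_pos_pairingIn
  rcases eq_or_ne i j with rfl | hij
  · exact .inl hj
  obtain ⟨k, hk⟩ := P.root_sub_root_mem_of_pairingIn_pos ((P.zero_lt_pairingIn_iff' ℤ).mp hji) hij
  exact .inr ⟨j, k, isPos_of_mem_support hj, hi.sub hj hk, by rw [hk, add_sub_cancel]⟩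

lemma isPos_smul_of_forall_mem_support {g : P.Aut} (h : ∀ i ∈ b.support, b.IsPos (g • i)) {i : ι}
    (hi : b.IsPos i) : b.IsPos (g • i) :=
  hi.induction_on_add h fun j k l hl hj hk ↦
    hj.add (h k hk) (by rw [root_smul, root_smul, root_smul, hl, smul_add])

lemma isPos_inv_smul_of_forall_mem_support {g : P.Aut} (h : ∀ i ∈ b.support, b.IsPos (g • i))
    {i : ι} (hi : b.IsPos i) : b.IsPos (g⁻¹ • i) := by
  have hg : g • {i | b.IsPos i} = {i | b.IsPos i} := by
    refine Set.eq_of_subset_of_ncard_le ?_ (Set.ncard_smul_set _ _).ge (Set.toFinite _)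
    rintro - ⟨i, hi, rfl⟩
    exact isPos_smul_of_forall_mem_support h hi
  exact Set.mem_smul_set_iff_inv_smul_mem.mp (hg.symm ▸ hi : i ∈ g • {i | b.IsPos i})

lemma smul_support_eq_of_forall_isPos {g : P.Aut} (h : ∀ i ∈ b.support, b.IsPos (g • i)) :
    g • (b.support : Set ι) = b.support := by
  refine Set.eq_of_subset_of_ncard_le ?_ (Set.ncard_smul_set _ _).ge (Set.toFinite _)
  rintro - ⟨i, hi, rfl⟩
  refine (mem_support_or_exists_root_eq_add (h i hi)).resolve_right ?_
  rintro ⟨j, k, hj, hk, hjk⟩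
  have hsum : P.root i = P.root (g⁻¹ • j) + P.root (g⁻¹ • k) := by
    rw [root_smul, root_smul, ← smul_add, ← hjk, root_smul, inv_smul_smul]
  have hheight := b.height_add hsum
  have hi_one := b.height_one_of_mem_support hi
  have hj_pos : 0 < b.height (g⁻¹ • j) := isPos_inv_smul_of_forall_mem_support h hj
  have hk_pos : 0 < b.height (g⁻¹ • k) := isPos_inv_smul_of_forall_mem_support h hk
  lia

end Positivity

section Inversions

variable [CharZero R]

/-- The inversions of an automorphism: the positive roots which it makes negative. Their number
measures how far the automorphism is from stabilizing the base. -/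
def inversionSet (b : P.Base) (g : P.Aut) : Set ι :=
  {j | b.IsPos j ∧ ¬ b.IsPos (g • j)}

lemma ncard_inversionSet_mul_reflection_lt [Finite ι] [IsDomain R] [P.IsCrystallographic]
    [P.IsReduced] {b : P.Base} {g : P.Aut} {i : ι} (hi : i ∈ b.support) (hgi : ¬ b.IsPos (g • i)) :
    (inversionSet b (g * Equiv.reflection P i)).ncard < (inversionSet b g).ncard := by
  have hi_pos : b.IsPos i := isPos_of_mem_support hi
  rw [← Set.ncard_image_of_injective _ (P.reflectionPerm i).injective]
  refine Set.ncard_lt_ncard ⟨?_, fun h ↦ ?_⟩ (Set.toFinite _)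
  · rintro - ⟨j, ⟨hj, hgj⟩, rfl⟩
    rw [mul_smul, reflection_smul_index] at hgj
    refine ⟨hj.reflectionPerm hi ?_, hgj⟩
    rintro rfl
    rw [smul_reflectionPerm_self, isPos_reflectionPerm_self_iff] at hgj
    exact hgj hgi
  · obtain ⟨j, ⟨hj, -⟩, hji⟩ := h (a := i) ⟨hi_pos, hgi⟩
    rw [← Equiv.eq_symm_apply, reflectionPerm_symm] at hji
    exact isPos_reflectionPerm_self_iff.mp (hji ▸ hj) hi_pos

end Inversions

section Dominant

/-- An additive functional on the weight space is dominant with respect to a base if it is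
nonnegative on the simple roots. -/
def IsDominant [LE S] (b : P.Base) (φ : M →+ S) : Prop :=
  ∀ i ∈ b.support, 0 ≤ φ (P.root i)

/-- The simple roots at which an additive functional vanishes. For a dominant functional these are
the walls of the fundamental chamber which contain it. -/
def simpleZeros (b : P.Base) (φ : M →+ S) : Set ι :=
  (b.support : Set ι) ∩ {i | φ (P.root i) = 0}

lemma mem_simpleStabilizer_simpleZeros {b : P.Base} {φ : M →+ S} {g : P.Aut}
    (hb : g • (b.support : Set ι) = b.support) (hg : g ∈ functionalStabilizer P φ) :
    g ∈ simpleStabilizer b (simpleZeros b φ) := by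
  have hzero : g • {i | φ (P.root i) = 0} = {i | φ (P.root i) = 0} := by
    ext i
    rw [Set.mem_smul_set_iff_inv_smul_mem, Set.mem_ofPred_eq, Set.mem_ofPred_eq, inv_mem hg i]
  refine Subgroup.mem_inf.mpr ⟨hb, ?_⟩
  rw [MulAction.mem_stabilizer_iff, simpleZeros, Set.smul_set_inter, hb, hzero]

lemma reflection_mem_reflectionSubgroup {I : Set ι} {i : ι} (hi : i ∈ I) :
    Equiv.reflection P i ∈ P.reflectionSubgroup I :=
  Subgroup.subset_closure (Set.mem_image_of_mem _ hi)

variable [PartialOrder S] [IsOrderedAddMonoid S] [CharZero R] [IsDomain R] [Finite ι]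
  [P.IsCrystallographic] {b : P.Base} {φ : M →+ S}

lemma IsDominant.apply_root_nonneg (hφ : IsDominant b φ) {i : ι} (hi : b.IsPos i) :
    0 ≤ φ (P.root i) :=
  hi.induction_on_add hφ fun j k l hl hj hk ↦ by
    rw [hl, map_add]
    exact add_nonneg hj (hφ k hk)

lemma IsDominant.apply_root_nonpos (hφ : IsDominant b φ) {i : ι} (hi : ¬ b.IsPos i) :
    φ (P.root i) ≤ 0 := by
  simpa using hφ.apply_root_nonneg (isPos_reflectionPerm_self_iff.mpr hi)

theorem IsDominant.functionalStabilizer_le_parabolicSubgroup [P.IsReduced]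
    (hφ : IsDominant b φ) :
    functionalStabilizer P φ ≤ parabolicSubgroup b (simpleZeros b φ) := by
  intro g hg
  induction hn : (inversionSet b g).ncard using Nat.strong_induction_on generalizing g with
  | _ n ih =>
    subst hn
    by_cases hpos : ∀ i ∈ b.support, b.IsPos (g • i)
    · exact le_sup_right (a := P.reflectionSubgroup _)
        (mem_simpleStabilizer_simpleZeros (smul_support_eq_of_forall_isPos hpos) hg)
    push Not at hpos
    obtain ⟨i, hi, hgi⟩ := hpos
    have hi_zero : φ (P.root i) = 0 :=
      le_antisymm ((hg i).ge.trans (hφ.apply_root_nonpos hgi)) (hφ i hi)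
    have hrefl : Equiv.reflection P i ∈ parabolicSubgroup b (simpleZeros b φ) :=
      le_sup_left (a := P.reflectionSubgroup _)
        (reflection_mem_reflectionSubgroup ⟨hi, hi_zero⟩)
    have hmul := ih _ (ncard_inversionSet_mul_reflection_lt hi hgi)
      (mul_mem hg (reflection_mem_functionalStabilizer hi_zero)) rfl
    exact (Subgroup.mul_mem_cancel_right _ hrefl).mp hmul

end Dominant

section Parabolic

variable [P.IsRootSystem] [P.IsCrystallographic] {b : P.Base} {I : Set ι}

lemma exists_ne_zero_parabolicSubgroup_le_functionalStabilizer [Nontrivial R]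
    (hI : I ⊂ b.support) :
    ∃ φ : Dual R M, φ ≠ 0 ∧ parabolicSubgroup b I ≤ functionalStabilizer P φ.toAddMonoidHom := by
  classical
  let φ : Dual R M := b.toWeightBasis.constr R fun i ↦ if (i : ι) ∈ I then 0 else 1
  have hφ (i : ι) (hi : i ∈ b.support) : φ (P.root i) = if i ∈ I then 0 else 1 := by
    simpa only [toWeightBasis_apply] using b.toWeightBasis.constr_basis R _ ⟨i, hi⟩
  refine ⟨φ, ?_, sup_le ?_ fun g hg ↦ ?_⟩
  · obtain ⟨i, hi, hiI⟩ := Set.exists_of_ssubset hI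
    intro h_zero
    simpa [h_zero, hiI] using hφ i hi
  · rw [reflectionSubgroup, Subgroup.closure_le]
    rintro - ⟨i, hi, rfl⟩
    exact reflection_mem_functionalStabilizer ((hφ i (hI.subset hi)).trans (if_pos hi))
  · refine mem_functionalStabilizer_of_forall_mem_support b fun i hi ↦ ?_
    have hgi : g • i ∈ b.support := hg.1.subset (Set.smul_mem_smul_set hi)
    have hgI : g • i ∈ I ↔ i ∈ I := by
      conv_lhs => rw [← MulAction.mem_stabilizer_iff.mp hg.2, Set.smul_mem_smul_set_iff]
    exact (hφ _ hgi).trans ((if_congr hgI rfl rfl).trans (hφ i hi).symm)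

theorem parabolicSubgroup_eq_top_iff [Finite ι] [CharZero R] [IsDomain R] [P.IsReduced]
    (hI : I ⊆ b.support) : parabolicSubgroup b I = ⊤ ↔ I = b.support := by
  refine ⟨fun htop ↦ by_contra fun hne ↦ ?_, ?_⟩
  · obtain ⟨φ, hφ, hle⟩ :=
      exists_ne_zero_parabolicSubgroup_le_functionalStabilizer (hI.ssubset_of_ne hne)
    refine hφ (dual_ext_root (P := P) fun i ↦ ?_)
    exact apply_root_eq_zero_of_reflection_mem (hle (htop ▸ Subgroup.mem_top _))
  · rintro rfl
    have hzero : IsDominant b (0 : M →+ ℤ) := fun _ _ ↦ le_rfl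
    refine top_le_iff.mp fun g _ ↦ ?_
    simpa [simpleZeros] using hzero.functionalStabilizer_le_parabolicSubgroup (x := g) fun _ ↦ rfl

end Parabolic

section Field

variable {K : Type*} [Field K] [CharZero K] [Module K M] [Module K N] [Finite ι]
  (P : RootPairing ι K M N) [P.IsRootSystem] [P.IsCrystallographic] [P.IsReduced]

lemma exists_base_forall_pos (ψ : M →+ ℚ) (hψ : ∀ i, ψ (P.root i) ≠ 0) :
    ∃ b : P.Base, ∀ i ∈ b.support, 0 < ψ (P.root i) := by
  let := P.indexNeg
  exact ⟨Base.mk' P (IsAddIndecomposable.baseOf P.root ψ) (P.linearIndepOn_root_baseOf ψ hψ)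
    fun i ↦ IsAddIndecomposable.mem_or_neg_mem_closure_baseOf P.root ψ i (hψ i) (by simp),
    fun i hi ↦ IsAddIndecomposable.baseOf_subset_pos P.root ψ ((Set.Finite.mem_toFinset _).mp hi)⟩

lemma exists_base_isDominant (φ : M →+ ℚ) : ∃ b : P.Base, IsDominant b φ := by
  let _ : Module ℚ M := Module.compHom M (algebraMap ℚ K)
  obtain ⟨ρ, hρ⟩ := exists_dual_forall_apply_ne_zero (K := ℚ) P.root fun i ↦ P.ne_zero i
  obtain ⟨n, hn⟩ :=
    exists_nsmul_add_ne_zero_and_nonneg (fun i ↦ φ (P.root i)) (fun i ↦ ρ (P.root i)) hρ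
  obtain ⟨b, hb⟩ := exists_base_forall_pos P (n • φ + ρ.toAddMonoidHom) fun i ↦ (hn i).1
  exact ⟨b, fun i hi ↦ (hn i).2 (hb i hi)⟩

variable {P}

theorem isElliptic_iff_forall_dual_eq_zero (w : P.Aut) :
    P.IsElliptic w ↔
      ∀ φ : Dual K M, w ∈ functionalStabilizer P φ.toAddMonoidHom → φ = 0 := by
  refine ⟨fun hw φ hwφ ↦ by_contra fun hφ ↦ ?_, ?_⟩
  · obtain ⟨i, hi⟩ : ∃ i, φ (P.root i) ≠ 0 := by
      contrapose! hφ
      exact dual_ext_root hφ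
    obtain ⟨f, hf⟩ : ∃ f : Dual ℚ K, f (φ (P.root i)) ≠ 0 := by
      contrapose! hi
      exact (forall_dual_apply_eq_zero_iff ℚ _).mp hi
    let ψ : M →+ ℚ := f.toAddMonoidHom.comp φ.toAddMonoidHom
    obtain ⟨b, hb⟩ := exists_base_isDominant P ψ
    refine hw _ ⟨b, _, Set.inter_subset_left, rfl⟩ ?_
      (hb.functionalStabilizer_le_parabolicSubgroup fun j ↦ congrArg f (hwφ j))
    rw [Ne, parabolicSubgroup_eq_top_iff Set.inter_subset_left, Set.inter_eq_left]
    exact fun hzero ↦ hf (apply_root_eq_of_forall_mem_support b (ψ := 0) hzero i)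
  · rintro hw - ⟨b, I, hI, rfl⟩ hproper hwI
    rw [Ne, parabolicSubgroup_eq_top_iff hI] at hproper
    obtain ⟨φ, hφ, hle⟩ :=
      exists_ne_zero_parabolicSubgroup_le_functionalStabilizer (hI.ssubset_of_ne hproper)
    exact hφ (hw φ (hle hwI))

end Field

end RootSystemAut

open RootSystemAut in
theorem mainTheorem8_general {ι K M N : Type*} [Finite ι] [Field K] [CharZero K]
    [AddCommGroup M] [Module K M] [AddCommGroup N] [Module K N]
    (P : RootPairing ι K M N) [P.IsRootSystem] [P.IsCrystallographic] [P.IsReduced]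
    (w : P.Aut) :
    P.IsElliptic w ↔ ¬ ∃ x ∈ Submodule.span K (Set.range P.root), x ≠ 0 ∧ w • x = x := by
  have : FiniteDimensional K M := .of_basis P.nonempty_base.some.toWeightBasis
  have hfix : (∃ x : M, x ≠ 0 ∧ w • x = x) ↔
      ∃ φ : Module.Dual K M, φ ≠ 0 ∧ w ∈ functionalStabilizer P φ.toAddMonoidHom := by
    simp only [mem_functionalStabilizer_dual_iff]
    exact exists_ne_zero_apply_eq_self_iff_exists_dual (RootPairing.Equiv.weightHom P w).toLinearMap
  rw [isElliptic_iff_forall_dual_eq_zero, RootPairing.IsRootSystem.span_root_eq_top]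
  simp only [Submodule.mem_top, true_and, hfix, not_exists, not_and', ne_eq, not_not]

theorem mainTheorem8 {ι M N : Type*} [Finite ι]
    [AddCommGroup M] [Module ℝ M] [AddCommGroup N] [Module ℝ N]
    (P : RootPairing ι ℝ M N) [P.IsRootSystem] [P.IsCrystallographic] [P.IsReduced]
    (w : P.Aut) :
    P.IsElliptic w ↔ ¬ ∃ x ∈ Submodule.span ℝ (Set.range P.root), x ≠ 0 ∧ w • x = x :=
  mainTheorem8_general P w
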